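/- **Theorem.** $\mathsf{RCA_0}$ proves that the SCT criterion for graphs implies the strong pigeonhole principle $\mathsf{SPP}$; that is, every (possibly nonstandard) model of $\mathsf{RCA_0}$ that satisfies the SCT criterion for graphs satisfies $\mathsf{SPP}$. Here $\mathsf{RCA_0}$ is the subsystem of second order arithmetic with the basic axioms for $0,1,+,\cdot,<$, induction for $\Sigma^0_1$-formulas and comprehension for $\Delta^0_1$-formulas (with number and set parameters). The following notions are understood inside $\mathsf{RCA_0}$, with finite objects coded by numbers. * $\mathsf{SPP}$: for every $k\in\mathbb N$ and every $c:\mathbb N\to\{0,\dots,k-1\}$ there is a set $I$ such that for all $i$, $i\in I$ if and only if $i<k$ and $c(x)=i$ for infinitely many $x$. * Every function identifier $f$ has an arity and a set $\mathrm{Var}(f)$ of that many parameters. A *size-change graph* $G:f\to g$ is a finite set of edges, a subset of $\mathrm{Var}(f)\times\{\downarrow,\Downarrow\}\times\mathrm{Var}(g)$, with at most one edge for any $x\in\mathrm{Var}(f)$ and $y\in\mathrm{Var}(g)$. An edge $(x,\downarrow,y)$ is a *strict arc*, written $x\xrightarrow{\downarrow}y$; an edge $(x,\Downarrow,y)$ is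 a *non-strict arc*. * The *composition* of $G_0:f\to g$ and $G_1:g\to h$ is the size-change graph $G_0;G_1:f\to h$ in which there is an edge from $x$ to $z$ iff for some $y\in\mathrm{Var}(g)$ there are edges from $x$ to $y$ in $G_0$ and from $y$ to $z$ in $G_1$; the edge is non-strict if for all such $y$ both edges are non-strict, and strict otherwise. $G$ is *idempotent* if $G;G=G$. For a finite set $\mathcal G$ of size-change graphs, $\mathsf{cl}(\mathcal G)$ is the smallest set that contains $\mathcal G$ and is closed under composition. * A *multipath* is an infinite sequence $G_0,G_1,\dots$ of size-change graphs such that the target of $G_n$ is the source of $G_{n+1}$ for all $n$. It has an *infinite descent* if for some $t$ there is a sequence of parameters $x_t,x_{t+1},\dots$ such that for every $n\ge t$ there is an edge from $x_n$ to $x_{n+1}$ in $G_n$, and this edge is strict for infinitely many $n$. A finite set $\mathcal G$ of size-change graphs is *SCT* if every multipath all of whose graphs belong to $\mathcal G$ has an infinite descent. * The *SCT criterion for graphs*: for every finite set $\mathcal G$ of size-change graphs, $\mathcal G$ is SCT if and only if every idempotent $G\in\mathsf{cl}(\mathcal G)$ has a strict arc $x\xrightarrow{\downarrow}x$ for some parameter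 $x$. -/

import Mathlib

/-- A structure for the two-sorted language of second order arithmetic: a number domain `M` with
`0, 1, +, ·, <`, and a nonempty set domain `sets` consisting of subsets of `M`, with true
membership.  (Any structure of this kind is allowed; in particular `M` may be nonstandard.) -/
class L2Structure (M : Type*) extends Zero M, One M, Add M, Mul M, LT M where
  sets : Set (Set M)
  sets_nonempty : sets.Nonempty

namespace SOA

/-! ### Bounded-quantifier formulas and the theory RCA₀ -/

/-- Numerical terms. -/
inductive NumTerm : Type
  | var : ℕ → NumTerm
  | zero : NumTerm
  | one : NumTerm
  | add : NumTerm → NumTerm → NumTerm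
  | mul : NumTerm → NumTerm → NumTerm

/-- Bounded-quantifier (that is, `Σ⁰₀`) formulas with free number and free set variables.  The
remaining connectives and the bounded existential quantifier are classically definable. -/
inductive BddFormula : Type
  | eq : NumTerm → NumTerm → BddFormula
  | lt : NumTerm → NumTerm → BddFormula
  | mem : NumTerm → ℕ → BddFormula
  | neg : BddFormula → BddFormula
  | and : BddFormula → BddFormula → BddFormula
  | ball : ℕ → NumTerm → BddFormula → BddFormula

section Semantics

variable {M : Type*} [L2Structure M]

/-- The value of a term under an assignment `v` of the number variables. -/
def NumTerm.val (v : ℕ → M) : NumTerm → M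
  | .var i => v i
  | .zero => 0
  | .one => 1
  | .add s t => s.val v + t.val v
  | .mul s t => s.val v * t.val v

/-- Truth of a bounded-quantifier formula under an assignment `v` of the number variables and an
assignment `w` of the set variables.  `ball i t φ` is `∀ xᵢ < t, φ`; the bound `t` is evaluated
outside the scope of the quantifier. -/
def BddFormula.Holds (w : ℕ → Set M) : BddFormula → (ℕ → M) → Prop
  | .eq s t, v => s.val v = t.val v
  | .lt s t, v => s.val v < t.val v
  | .mem t j, v => t.val v ∈ w j
  | .neg φ, v => ¬ φ.Holds w v
  | .and φ ψ, v => φ.Holds w v ∧ ψ.Holds w v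
  | .ball i t φ, v => ∀ a : M, a < t.val v → φ.Holds w (Function.update v i a)

/-- The value of `θ(n, m, parameters)`: variable `0` is `n`, variable `1` is `m`, and all other
number variables and all set variables are parameters. -/
def BddFormula.At (θ : BddFormula) (w : ℕ → Set M) (v : ℕ → M) (n m : M) : Prop :=
  θ.Holds w (Function.update (Function.update v 0 n) 1 m)

end Semantics

/-- `M` is a model of `RCA₀`: the basic axioms of arithmetic, induction for `Σ⁰₁` formulas
`∃ m θ(n, m)`, and `Δ⁰₁` comprehension, both with arbitrary number and set parameters. -/
structure RCA0 (M : Type*) [L2Structure M] : Prop where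
  succ_ne_zero : ∀ n : M, n + 1 ≠ 0
  succ_inj : ∀ m n : M, m + 1 = n + 1 → m = n
  add_zero : ∀ m : M, m + 0 = m
  add_succ : ∀ m n : M, m + (n + 1) = (m + n) + 1
  mul_zero : ∀ m : M, m * 0 = 0
  mul_succ : ∀ m n : M, m * (n + 1) = m * n + m
  not_lt_zero : ∀ m : M, ¬ m < 0
  lt_succ : ∀ m n : M, m < n + 1 ↔ (m < n ∨ m = n)
  sigma01_induction : ∀ (θ : BddFormula) (v : ℕ → M) (w : ℕ → Set M),
    (∀ j, w j ∈ L2Structure.sets) →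
    (∃ m, θ.At w v 0 m) →
    (∀ n, (∃ m, θ.At w v n m) → ∃ m, θ.At w v (n + 1) m) →
    ∀ n, ∃ m, θ.At w v n m
  delta01_comprehension : ∀ (θ η : BddFormula) (v : ℕ → M) (w : ℕ → Set M),
    (∀ j, w j ∈ L2Structure.sets) →
    (∀ n, (∃ m, θ.At w v n m) ↔ ∀ m, η.At w v n m) →
    ∃ X ∈ (L2Structure.sets : Set (Set M)), ∀ n, n ∈ X ↔ ∃ m, θ.At w v n m

section Internal

/-! ### Coding inside a structure

From here on every quantifier over numbers ranges over `M` and every quantifier over sets ranges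
over `L2Structure.sets`, so that each notion is the interpretation in the structure of a notion of
second order arithmetic. -/

variable {M : Type*} [L2Structure M]

/-- The code `(i + j)² + i` of an ordered pair. -/
def pair (i j : M) : M := (i + j) * (i + j) + i

/-- `∃^∞ x, P x`. -/
def InfMany (P : M → Prop) : Prop := ∀ n : M, ∃ x, n < x ∧ P x

/-- `c` represents a finite set through `c = ((k, m), n)`. -/
def FinRep (c : M) : Prop := ∃ k m n : M, c = pair (pair k m) n

/-- `i` belongs to the finite set `{i < k : m(i+1)+1 divides n}` represented by
`c = ((k, m), n)`. -/
def FinMem (i c : M) : Prop :=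
  ∃ k m n : M, c = pair (pair k m) n ∧ i < k ∧ ∃ q : M, n = (m * (i + 1) + 1) * q

/-- `c` is the code of a finite set: the least number representing that set. -/
def IsFinCode (c : M) : Prop :=
  FinRep c ∧ ∀ d : M, d < c → FinRep d → ¬ ∀ i : M, FinMem i d ↔ FinMem i c

variable (M) in
/-- A (total) function `ℕ → ℕ` of the structure: a set of pairs, belonging to the set domain,
that is total and single valued. -/
structure Func where
  graph : Set M
  graph_mem : graph ∈ L2Structure.sets
  isPair : ∀ p ∈ graph, ∃ x y : M, p = pair x y
  total : ∀ x : M, ∃! y : M, pair x y ∈ graph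

/-- `F x` is the unique `y` with `(x, y) ∈ F`. -/
noncomputable instance : CoeFun (Func M) (fun _ => M → M) :=
  ⟨fun F x => (F.total x).exists.choose⟩

variable (M) in
/-- The strong pigeonhole principle: for all `k` and all `c : ℕ → k` there is a set `I` with
`i ∈ I` iff `i < k` and `c x = i` for infinitely many `x`. -/
def SPP : Prop :=
  ∀ (k : M) (c : Func M), (∀ x, c x < k) →
    ∃ I ∈ (L2Structure.sets : Set (Set M)), ∀ i, i ∈ I ↔ (i < k ∧ InfMany fun x => c x = i)

/-! ### Size-change graphs -/

/-- The two kinds of arcs: `down` is the strict arc `↓`, `weak` the non-strict arc `⇓`. -/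
inductive Label : Type
  | down : Label
  | weak : Label

/-- The code of a label. -/
def Label.code : Label → M
  | .down => 0
  | .weak => 1

/-- The code of the edge `(x, r, y)`. -/
def edge (x : M) (r : Label) (y : M) : M := pair (pair x r.code) y

variable (M) in
/-- A function identifier with its arity; its parameters are the numbers `x < arity`. -/
@[ext] structure FunId where
  name : M
  arity : M

/-- `x` is a parameter of `f`. -/
def FunId.Var (f : FunId M) (x : M) : Prop := x < f.arity

/-- The code of a function identifier. -/
def FunId.code (f : FunId M) : M := pair f.name f.arity

variable (M) in
/-- A size-change graph `G : src → tgt`: a (coded) finite set of edges, included in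
`var(src) × {↓, ⇓} × var(tgt)`, with at most one edge for any `x` and `y`. -/
structure SCGraph where
  src : FunId M
  tgt : FunId M
  edges : M
  edges_isFinCode : IsFinCode edges
  edges_sub : ∀ e, FinMem e edges →
    ∃ (x : M) (r : Label) (y : M), src.Var x ∧ tgt.Var y ∧ e = edge x r y
  edges_unique : ∀ (x : M) (r r' : Label) (y : M),
    FinMem (edge x r y) edges → FinMem (edge x r' y) edges → r = r'

/-- The graph `G` has the edge `(x, r, y)`. -/
def SCGraph.Arc (G : SCGraph M) (x : M) (r : Label) (y : M) : Prop :=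
  FinMem (edge x r y) G.edges

/-- The code of a size-change graph. -/
def SCGraph.code (G : SCGraph M) : M := pair (pair G.src.code G.tgt.code) G.edges

/-- `G₀ ; G₁` is defined and equals `H`. -/
def IsComp (G₀ G₁ H : SCGraph M) : Prop :=
  G₀.tgt = G₁.src ∧ H.src = G₀.src ∧ H.tgt = G₁.tgt ∧
  (∀ x z, H.Arc x .down z ↔
    ∃ y, G₀.tgt.Var y ∧ ∃ r,
      (G₀.Arc x .down y ∧ G₁.Arc y r z) ∨ (G₀.Arc x r y ∧ G₁.Arc y .down z)) ∧
  (∀ x z, H.Arc x .weak z ↔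
    (∃ y, G₀.tgt.Var y ∧ G₀.Arc x .weak y ∧ G₁.Arc y .weak z) ∧
    ∀ y, G₀.tgt.Var y → ∀ r r', G₀.Arc x r y ∧ G₁.Arc y r' z → r = .weak ∧ r' = .weak)

/-- `G ; G = G`. -/
def SCGraph.Idempotent (G : SCGraph M) : Prop := IsComp G G G

/-- `𝒢` is (the set of codes of) a finite set of size-change graphs. -/
def IsFinGraphSet (𝒢 : Set M) : Prop :=
  𝒢 ∈ L2Structure.sets ∧ (∃ b : M, ∀ a ∈ 𝒢, a < b) ∧ ∀ a ∈ 𝒢, ∃ G : SCGraph M, a = G.code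

/-- `G` belongs to `cl(𝒢)`, the smallest set containing `𝒢` and closed under composition. -/
def InClosure (𝒢 : Set M) (G : SCGraph M) : Prop :=
  ∀ X ∈ (L2Structure.sets : Set (Set M)), 𝒢 ⊆ X →
    (∀ G₀ G₁ H : SCGraph M, G₀.code ∈ X → G₁.code ∈ X → IsComp G₀ G₁ H → H.code ∈ X) →
    G.code ∈ X

/-- `π` is an infinite multipath `G₀, G₁, …`: the target of each graph is the source of the
next one. -/
def IsMultipath (π : Func M) : Prop :=
  ∀ n, ∃ G H : SCGraph M, π n = G.code ∧ π (n + 1) = H.code ∧ G.tgt = H.src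

/-- The `n`-th graph of `π` has the edge `(x, r, y)`. -/
def ArcAt (π : Func M) (n : M) (x : M) (r : Label) (y : M) : Prop :=
  ∃ G : SCGraph M, π n = G.code ∧ G.Arc x r y

/-- Some thread `θ 0 → θ 1 → …` of `π`, starting at the graph with some index `t`, has infinitely
many strict arcs. -/
def HasInfiniteDescent (π : Func M) : Prop :=
  ∃ (t : M) (θ : Func M),
    (∀ j, ∃ r, ArcAt π (t + j) (θ j) r (θ (j + 1))) ∧
    InfMany fun j => ArcAt π (t + j) (θ j) .down (θ (j + 1))

/-- `𝒢` is size-change terminating: every infinite multipath of graphs from `𝒢` has an infinite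
descent. -/
def IsSCT (𝒢 : Set M) : Prop :=
  ∀ π : Func M, IsMultipath π → (∀ n, π n ∈ 𝒢) → HasInfiniteDescent π

variable (M) in
/-- The SCT criterion for graphs: a finite set `𝒢` of size-change graphs is SCT iff every
idempotent `G ∈ cl(𝒢)` has a strict arc from some parameter to itself. -/
def SCTCriterion : Prop :=
  ∀ 𝒢 : Set M, IsFinGraphSet 𝒢 →
    (IsSCT 𝒢 ↔ ∀ G : SCGraph M, InClosure 𝒢 G → G.Idempotent → ∃ x, G.Arc x .down x)

end Internal

end SOA

/-! The principle follows from the existence of a limit inferior for bounded functions, and the SCT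
criterion supplies such limits without any induction beyond `Σ⁰₁`.

For parameters `x < K`, let the `n`-th parity graph have only loops: weak ones below `n` and a
strict one at `n`. Composing two of these graphs takes the minimum of their indices
(`IsComp.eq_parityGraph`), so the finite family is closed under composition. Every member has a
strict loop, hence the criterion makes the family SCT. Given `d` bounded by `K`, an infinite descent
in the multipath of graphs with indices `d s` must stay at one parameter `n`: eventually `n ≤ d s`,
and `d s = n` infinitely often. This is `SCTCriterion.exists_liminf`.

Now let `c` have colours below `k`. With `m` a positive common multiple of `1, …, k`, the moduli `m
(i + 1) + 1` for `i < k` behave like distinct primes (`modulus_euclid`), and a positive `n` selects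
the colours whose modulus does not divide `n`. The predicate `Fires` is a bounded test at stage `s`
that succeeds infinitely often exactly when every selected colour occurs infinitely often
(`infMany_of_infMany_fires`, `infMany_fires`). Let `d s` be the least positive `n` that fires at
`s`, and `n` its limit inferior. All colours selected by `n` recur. If a recurring colour were not
selected, dividing `n` by its modulus would give a smaller number that also fires infinitely often,
against the eventual lower bound. So the recurring colours are those selected by `n`, a set defined
by a bounded formula.

All definability is delegated to instance search through the classes `Tm` and `Bd`. -/

namespace SOA

/-! ### Definability by bounded-quantifier formulas -/

section Definability

/-- Renaming of the variables of a term. -/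
def NumTerm.rename (f : ℕ → ℕ) : NumTerm → NumTerm
  | .var i => .var (f i)
  | .zero => .zero
  | .one => .one
  | .add s t => .add (s.rename f) (t.rename f)
  | .mul s t => .mul (s.rename f) (t.rename f)

/-- Renaming of the number variables and the set variables of a formula. -/
def BddFormula.rename (f g : ℕ → ℕ) : BddFormula → BddFormula
  | .eq s t => .eq (s.rename f) (t.rename f)
  | .lt s t => .lt (s.rename f) (t.rename f)
  | .mem t j => .mem (t.rename f) (g j)
  | .neg φ => .neg (φ.rename f g)
  | .and φ ψ => .and (φ.rename f g) (ψ.rename f g)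
  | .ball i t φ => .ball (f i) (t.rename f) (φ.rename f g)

variable {M : Type*} [L2Structure M]

theorem NumTerm.val_rename (f : ℕ → ℕ) (u : ℕ → M) (t : NumTerm) :
    (t.rename f).val u = t.val (u ∘ f) := by
  induction t with
  | add s t hs ht => simp [NumTerm.rename, NumTerm.val, hs, ht]
  | mul s t hs ht => simp [NumTerm.rename, NumTerm.val, hs, ht]
  | _ => rfl

theorem BddFormula.holds_rename {f : ℕ → ℕ} (hf : f.Injective) (g : ℕ → ℕ) (w : ℕ → Set M)
    (φ : BddFormula) (u : ℕ → M) :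
    (φ.rename f g).Holds w u ↔ φ.Holds (w ∘ g) (u ∘ f) := by
  induction φ generalizing u with
  | neg φ ih => simp [BddFormula.rename, BddFormula.Holds, ih]
  | and φ ψ ih₁ ih₂ => simp [BddFormula.rename, BddFormula.Holds, ih₁, ih₂]
  | ball i t φ ih =>
    simp [BddFormula.rename, BddFormula.Holds, ih, NumTerm.val_rename,
      Function.update_comp_eq_of_injective _ hf]
  | _ => simp [BddFormula.rename, BddFormula.Holds, NumTerm.val_rename]

/-- `t` is the value of a numerical term with number parameters.  The argument of `t` is read off
the variables `3 i`, and the parameters are the values of the variables `3 i + 1`. -/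
class Tm (t : (ℕ → M) → M) : Prop where
  out : ∃ (τ : NumTerm) (p : ℕ → M), ∀ u : ℕ → M, (∀ i, u (3 * i + 1) = p i) →
    τ.val u = t fun i => u (3 * i)

/-- `P` is defined by a bounded-quantifier formula with number and set parameters. -/
class Bd (P : (ℕ → M) → Prop) : Prop where
  out : ∃ (θ : BddFormula) (p : ℕ → M) (w : ℕ → Set M), (∀ j, w j ∈ L2Structure.sets) ∧
    ∀ u : ℕ → M, (∀ i, u (3 * i + 1) = p i) → (θ.Holds w u ↔ P fun i => u (3 * i))

/-- Moves parameters to even places. -/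
def evenParam (n : ℕ) : ℕ := if n % 3 = 1 then 2 * n - 1 else n

/-- Moves parameters to odd places. -/
def oddParam (n : ℕ) : ℕ := if n % 3 = 1 then 2 * n + 2 else n

/-- Alternates between two sequences. -/
def interleave {α : Type*} (p q : ℕ → α) (n : ℕ) : α := if n % 2 = 0 then p (n / 2) else q (n / 2)

theorem evenParam_injective : Function.Injective evenParam := by
  intro a b h
  simp only [evenParam] at h
  split_ifs at h <;> omega

theorem oddParam_injective : Function.Injective oddParam := by
  intro a b h
  simp only [oddParam] at h
  split_ifs at h <;> omega

theorem interleave_even {α : Type*} (p q : ℕ → α) (n : ℕ) : interleave p q (2 * n) = p n := by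
  simp [interleave]

theorem interleave_odd {α : Type*} (p q : ℕ → α) (n : ℕ) :
    interleave p q (2 * n + 1) = q n := by
  have : (2 * n + 1) / 2 = n := by omega
  simp [interleave, this]

theorem evenParam_three_mul (i : ℕ) : evenParam (3 * i) = 3 * i := by
  simp [evenParam]

theorem oddParam_three_mul (i : ℕ) : oddParam (3 * i) = 3 * i := by
  simp [oddParam]

theorem evenParam_param (i : ℕ) : evenParam (3 * i + 1) = 3 * (2 * i) + 1 := by
  have : (3 * i + 1) % 3 = 1 := by omega
  simp only [evenParam, this, if_true]; omega

theorem oddParam_param (i : ℕ) : oddParam (3 * i + 1) = 3 * (2 * i + 1) + 1 := by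
  have : (3 * i + 1) % 3 = 1 := by omega
  simp only [oddParam, this, if_true]; omega

/-- Two terms may use the same parameter slots for different values; renaming sends the slots of one
to even and of the other to odd positions and leaves the arguments alone. -/
theorem Tm.exists₂ (s t : (ℕ → M) → M) [hs : Tm s] [ht : Tm t] :
    ∃ (σ τ : NumTerm) (p : ℕ → M), ∀ u : ℕ → M, (∀ i, u (3 * i + 1) = p i) →
      σ.val u = s (fun i => u (3 * i)) ∧ τ.val u = t (fun i => u (3 * i)) := by
  obtain ⟨σ, p, h₁⟩ := hs.out
  obtain ⟨τ, q, h₂⟩ := ht.out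
  refine ⟨σ.rename evenParam, τ.rename oddParam, interleave p q, fun u hu => ⟨?_, ?_⟩⟩
  · rw [NumTerm.val_rename, h₁]
    · simp [evenParam_three_mul]
    · intro i; simp [evenParam_param, hu, interleave_even]
  · rw [NumTerm.val_rename, h₂]
    · simp [oddParam_three_mul]
    · intro i; simp [oddParam_param, hu, interleave_odd]

instance Tm.const (a : M) : Tm fun _ : ℕ → M => a :=
  ⟨.var 1, fun _ => a, fun _ hu => hu 0⟩

instance Tm.var (i : ℕ) : Tm fun v : ℕ → M => v i :=
  ⟨.var (3 * i), fun _ => 0, fun _ _ => rfl⟩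

instance Tm.add (s t : (ℕ → M) → M) [Tm s] [Tm t] : Tm fun v => s v + t v := by
  obtain ⟨σ, τ, p, h⟩ := Tm.exists₂ s t
  exact ⟨.add σ τ, p, fun u hu => by simp [NumTerm.val, h u hu]⟩

instance Tm.mul (s t : (ℕ → M) → M) [Tm s] [Tm t] : Tm fun v => s v * t v := by
  obtain ⟨σ, τ, p, h⟩ := Tm.exists₂ s t
  exact ⟨.mul σ τ, p, fun u hu => by simp [NumTerm.val, h u hu]⟩

/-- Needed under quantifiers, where the outer variables appear shifted by one. -/
instance Tm.reindex (f : ℕ → ℕ) (t : (ℕ → M) → M) [ht : Tm t] :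
    Tm fun v => t fun i => v (f i) := by
  obtain ⟨τ, p, h⟩ := ht.out
  refine ⟨τ.rename fun n => if n % 3 = 0 then 3 * f (n / 3) else n, p, fun u hu => ?_⟩
  rw [NumTerm.val_rename, h]
  · simp
  · intro i
    simp [hu]

instance Bd.eq (s t : (ℕ → M) → M) [Tm s] [Tm t] : Bd fun v => s v = t v := by
  obtain ⟨σ, τ, p, h⟩ := Tm.exists₂ s t
  obtain ⟨X, hX⟩ := L2Structure.sets_nonempty (M := M)
  exact ⟨.eq σ τ, p, fun _ => X, fun _ => hX, fun u hu => by simp [BddFormula.Holds, h u hu]⟩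

instance Bd.lt (s t : (ℕ → M) → M) [Tm s] [Tm t] : Bd fun v => s v < t v := by
  obtain ⟨σ, τ, p, h⟩ := Tm.exists₂ s t
  obtain ⟨X, hX⟩ := L2Structure.sets_nonempty (M := M)
  exact ⟨.lt σ τ, p, fun _ => X, fun _ => hX, fun u hu => by simp [BddFormula.Holds, h u hu]⟩

instance Bd.mem (t : (ℕ → M) → M) (X : Set M) [ht : Tm t]
    [hX : Fact (X ∈ L2Structure.sets)] : Bd fun v => t v ∈ X := by
  obtain ⟨τ, p, h⟩ := ht.out
  exact ⟨.mem τ 0, p, fun _ => X, fun _ => hX.out, fun u hu => by simp [BddFormula.Holds, h u hu]⟩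

instance Bd.not (P : (ℕ → M) → Prop) [hP : Bd P] : Bd fun v => ¬ P v := by
  obtain ⟨θ, p, w, hw, h⟩ := hP.out
  exact ⟨.neg θ, p, w, hw, fun u hu => by simp [BddFormula.Holds, h u hu]⟩

instance Bd.and (P Q : (ℕ → M) → Prop) [hP : Bd P] [hQ : Bd Q] : Bd fun v => P v ∧ Q v := by
  obtain ⟨θ, p, w, hw, h⟩ := hP.out
  obtain ⟨η, q, z, hz, h'⟩ := hQ.out
  refine ⟨.and (θ.rename evenParam (2 * ·)) (η.rename oddParam (2 * · + 1)), interleave p q,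
    interleave w z, fun j => ?_, fun u hu => ?_⟩
  · unfold interleave
    split_ifs
    exacts [hw _, hz _]
  · have e₁ : interleave w z ∘ (2 * ·) = w := funext fun _ => interleave_even ..
    have e₂ : interleave w z ∘ (2 * · + 1) = z := funext fun _ => interleave_odd ..
    simp only [BddFormula.Holds, BddFormula.holds_rename evenParam_injective,
      BddFormula.holds_rename oddParam_injective, e₁, e₂]
    rw [h, h']
    · simp [evenParam_three_mul, oddParam_three_mul]
    · intro i; simp [oddParam_param, hu, interleave_odd]
    · intro i; simp [evenParam_param, hu, interleave_even]

theorem Bd.congr {P Q : (ℕ → M) → Prop} [hP : Bd P] (h : ∀ v, Q v ↔ P v) : Bd Q :=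
  (funext fun v => propext (h v) : Q = P) ▸ hP

instance Bd.or (P Q : (ℕ → M) → Prop) [Bd P] [Bd Q] : Bd fun v => P v ∨ Q v :=
  .congr (P := fun v => ¬ (¬ P v ∧ ¬ Q v)) fun _ => by tauto

instance Bd.imp (P Q : (ℕ → M) → Prop) [Bd P] [Bd Q] : Bd fun v => P v → Q v :=
  .congr (P := fun v => ¬ (P v ∧ ¬ Q v)) fun _ => by tauto

instance Bd.iff (P Q : (ℕ → M) → Prop) [Bd P] [Bd Q] : Bd fun v => P v ↔ Q v :=
  .congr (P := fun v => (P v → Q v) ∧ (Q v → P v)) fun _ => by tauto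

/-- Makes the variable of number `0` the bound one. -/
def bindVar (n : ℕ) : ℕ :=
  if n = 0 then 2 else if n % 3 = 0 then n - 3 else if n % 3 = 1 then n else n + 3

theorem bindVar_injective : Function.Injective bindVar := by
  intro a b h
  simp only [bindVar] at h
  split_ifs at h <;> omega

/-- The body is read in de Bruijn style, with the quantified variable at index `0`. Syntactically
that variable goes to slot `2`, which `bindVar` keeps free by moving the other slots `3 i + 2` up.
-/
instance Bd.ball (t : (ℕ → M) → M) (Q : M → (ℕ → M) → Prop) [ht : Tm t]
    [hQ : Bd fun v => Q (v 0) fun i => v (i + 1)] : Bd fun v => ∀ a, a < t v → Q a v := by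
  obtain ⟨θ, p, w, hw, h⟩ := hQ.out
  obtain ⟨τ, q, h'⟩ := ht.out
  refine ⟨.ball 2 (τ.rename oddParam) ((θ.rename evenParam id).rename bindVar id), interleave p q,
    w, hw, fun u hu => ?_⟩
  simp only [BddFormula.Holds, BddFormula.holds_rename evenParam_injective,
    BddFormula.holds_rename bindVar_injective, Function.comp_id, NumTerm.val_rename]
  rw [h']
  · simp only [Function.comp_apply, oddParam_three_mul]
    refine forall₂_congr fun a _ => ?_
    rw [h]
    · simp only [Function.comp_apply, evenParam_three_mul]
      have h0 : Function.update u 2 a (bindVar (3 * 0)) = a := by simp [bindVar]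
      have h1 : (fun i => Function.update u 2 a (bindVar (3 * (i + 1)))) = fun i => u (3 * i) := by
        funext i
        have : bindVar (3 * (i + 1)) = 3 * i := by
          have : 3 * (i + 1) % 3 = 0 := by omega
          simp [bindVar, this]; omega
        rw [this, Function.update_of_ne (by omega)]
      rw [h0, h1]
    · intro i
      have : bindVar (3 * (2 * i) + 1) = 3 * (2 * i) + 1 := by
        have : (3 * (2 * i) + 1) % 3 = 1 := by omega
        simp [bindVar, this]
      simp only [Function.comp_apply, evenParam_param, this]
      rw [Function.update_of_ne (by omega), hu, interleave_even]
  · intro i; simp [oddParam_param, hu, interleave_odd]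

instance Bd.bex (t : (ℕ → M) → M) (Q : M → (ℕ → M) → Prop) [Tm t]
    [Bd fun v => Q (v 0) fun i => v (i + 1)] : Bd fun v => ∃ a, a < t v ∧ Q a v :=
  .congr (P := fun v => ¬ ∀ a, a < t v → ¬ Q a v) fun _ => by push Not; rfl

/-- Makes the first two variables those of numbers `0` and `1`. -/
def headVars (n : ℕ) : ℕ := if n = 0 then 0 else if n = 3 then 1 else n + 2

theorem headVars_injective : Function.Injective headVars := by
  intro a b h
  simp only [headVars] at h
  split_ifs at h <;> omega

theorem Bd.exists_at (P : M → M → Prop) [hP : Bd fun v : ℕ → M => P (v 0) (v 1)] :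
    ∃ (θ : BddFormula) (v : ℕ → M) (w : ℕ → Set M), (∀ j, w j ∈ L2Structure.sets) ∧
      ∀ n m, θ.At w v n m ↔ P n m := by
  obtain ⟨θ, p, w, hw, h⟩ := hP.out
  refine ⟨θ.rename headVars id, fun n => p ((n - 3) / 3), w, hw, fun n m => ?_⟩
  rw [BddFormula.At, BddFormula.holds_rename headVars_injective, Function.comp_id, h]
  · simp [headVars]
  · intro i
    have : headVars (3 * i + 1) = 3 * i + 3 := by simp [headVars]; omega
    simp only [Function.comp_apply, this]
    rw [Function.update_of_ne (by omega), Function.update_of_ne (by omega)]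
    congr 1; omega

theorem RCA0.sigma_induction (hM : RCA0 M) (P : M → M → Prop) [Bd fun v : ℕ → M => P (v 0) (v 1)]
    (h0 : ∃ m, P 0 m) (hs : ∀ n, (∃ m, P n m) → ∃ m, P (n + 1) m) (n : M) : ∃ m, P n m := by
  obtain ⟨θ, v, w, hw, h⟩ := Bd.exists_at P
  simp only [← h] at h0 hs ⊢
  exact hM.sigma01_induction θ v w hw h0 hs n

theorem RCA0.induction (hM : RCA0 M) (P : M → Prop) [h : Bd fun v : ℕ → M => P (v 0)]
    (h0 : P 0) (hs : ∀ n, P n → P (n + 1)) (n : M) : P n := by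
  obtain ⟨_, h⟩ := RCA0.sigma_induction hM (fun n _ => P n) ⟨0, h0⟩
    (fun n ⟨_, h⟩ => ⟨0, hs n h⟩) n
  exact h

theorem RCA0.comprehension (hM : RCA0 M) (P : M → Prop) [h : Bd fun v : ℕ → M => P (v 0)] :
    {n | P n} ∈ (L2Structure.sets : Set (Set M)) := by
  obtain ⟨θ, v, w, hw, h⟩ := Bd.exists_at fun n _ => P n
  -- The truth of `θ` does not depend on `m`, so it serves as both the existential and the universal
  -- form.
  obtain ⟨X, hX, h'⟩ := hM.delta01_comprehension θ θ v w hw fun n => by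
    simp only [h]; exact ⟨fun ⟨_, h⟩ _ => h, fun h => ⟨0, h 0⟩⟩
  have : X = {n | P n} := by
    ext n; rw [h' n]; simp only [h]; exact ⟨fun ⟨_, h⟩ => h, fun h => ⟨0, h⟩⟩
  exact this ▸ hX

end Definability

/-! ### Arithmetic in a model of `RCA₀` -/

section Arithmetic

namespace RCA0

variable {M : Type*} [L2Structure M]

theorem zero_add (hM : RCA0 M) (n : M) : 0 + n = n := by
  refine hM.induction (fun n => 0 + n = n) (hM.add_zero 0) (fun n h => ?_) n
  rw [hM.add_succ, h]

theorem succ_add (hM : RCA0 M) (m n : M) : m + 1 + n = m + n + 1 := by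
  refine hM.induction (fun n => m + 1 + n = m + n + 1) ?_ (fun n h => ?_) n
  · rw [hM.add_zero, hM.add_zero]
  · rw [hM.add_succ, hM.add_succ, h]

theorem add_comm (hM : RCA0 M) (m n : M) : m + n = n + m := by
  refine hM.induction (fun n => m + n = n + m) ?_ (fun n h => ?_) n
  · rw [hM.add_zero, hM.zero_add]
  · rw [hM.add_succ, hM.succ_add, h]

theorem add_assoc (hM : RCA0 M) (a b c : M) : a + b + c = a + (b + c) := by
  refine hM.induction (fun c => a + b + c = a + (b + c)) ?_ (fun n h => ?_) c
  · rw [hM.add_zero, hM.add_zero]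
  · rw [hM.add_succ, hM.add_succ, hM.add_succ, h]

theorem add_right_cancel (hM : RCA0 M) {a b c : M} : a + c = b + c → a = b := by
  refine hM.induction (fun c => a + c = b + c → a = b) ?_ (fun n h => ?_) c
  · rw [hM.add_zero, hM.add_zero]; exact id
  · rw [hM.add_succ, hM.add_succ]; exact fun e => h (hM.succ_inj _ _ e)

theorem zero_mul (hM : RCA0 M) (n : M) : 0 * n = 0 := by
  refine hM.induction (fun n => 0 * n = 0) (hM.mul_zero 0) (fun n h => ?_) n
  rw [hM.mul_succ, h, hM.add_zero]

theorem succ_mul (hM : RCA0 M) (m n : M) : (m + 1) * n = m * n + n := by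
  refine hM.induction (fun n => (m + 1) * n = m * n + n) ?_ (fun n h => ?_) n
  · rw [hM.mul_zero, hM.mul_zero, hM.add_zero]
  · rw [hM.mul_succ, hM.mul_succ, h, hM.add_succ (m * n + n) m, hM.add_succ (m * n + m) n,
      hM.add_assoc (m * n) n m, hM.add_comm n m, ← hM.add_assoc]

theorem mul_comm (hM : RCA0 M) (m n : M) : m * n = n * m := by
  refine hM.induction (fun n => m * n = n * m) ?_ (fun n h => ?_) n
  · rw [hM.mul_zero, hM.zero_mul]
  · rw [hM.mul_succ, hM.succ_mul, h]

theorem mul_add (hM : RCA0 M) (a b c : M) : a * (b + c) = a * b + a * c := by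
  refine hM.induction (fun c => a * (b + c) = a * b + a * c) ?_ (fun n h => ?_) c
  · rw [hM.mul_zero, hM.add_zero, hM.add_zero]
  · rw [hM.mul_succ, hM.add_succ, hM.mul_succ, h, hM.add_assoc]

theorem mul_assoc (hM : RCA0 M) (a b c : M) : a * b * c = a * (b * c) := by
  refine hM.induction (fun c => a * b * c = a * (b * c)) ?_ (fun n h => ?_) c
  · rw [hM.mul_zero, hM.mul_zero, hM.mul_zero]
  · rw [hM.mul_succ, hM.mul_succ, h, hM.mul_add]

theorem mul_one (hM : RCA0 M) (a : M) : a * 1 = a := by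
  rw [← hM.zero_add 1, hM.mul_succ, hM.mul_zero, hM.zero_add]

theorem eq_zero_or_succ (hM : RCA0 M) (n : M) : n = 0 ∨ ∃ m, n = m + 1 := by
  obtain ⟨m, h⟩ := hM.sigma_induction (fun n m => n = 0 ∨ n = m + 1) ⟨0, .inl rfl⟩
    (fun n _ => ⟨n, .inr rfl⟩) n
  exact h.imp_right fun h => ⟨m, h⟩

theorem lt_iff_exists (hM : RCA0 M) (m n : M) : m < n ↔ ∃ r, n = m + r + 1 := by
  constructor
  · intro h
    obtain ⟨r, h'⟩ := hM.sigma_induction (fun n r => m < n → n = m + r + 1)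
      ⟨0, fun h => (hM.not_lt_zero _ h).elim⟩ (fun n ⟨r, h⟩ => by
        by_cases e : m = n
        · exact ⟨0, fun _ => by rw [hM.add_zero, e]⟩
        · refine ⟨r + 1, fun h' => ?_⟩
          rw [hM.add_succ, ← h (((hM.lt_succ _ _).1 h').resolve_right e)]) n
    exact ⟨r, h' h⟩
  · rintro ⟨r, rfl⟩
    refine hM.induction (fun r => m < m + r + 1) ?_ (fun r h => ?_) r
    · rw [hM.add_zero]; exact (hM.lt_succ _ _).2 (.inr rfl)
    · rw [hM.add_succ]; exact (hM.lt_succ _ _).2 (.inl h)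

theorem le_iff_exists (hM : RCA0 M) (m n : M) : (m < n ∨ m = n) ↔ ∃ r, n = m + r := by
  rw [← hM.lt_succ, hM.lt_iff_exists]
  exact exists_congr fun r => ⟨hM.succ_inj _ _, fun h => by rw [h]⟩

theorem lt_trichotomy (hM : RCA0 M) (m n : M) : m < n ∨ m = n ∨ n < m := by
  refine hM.induction (fun n => m < n ∨ m = n ∨ n < m) ?_ (fun n h => ?_) n
  · rcases hM.eq_zero_or_succ m with h | ⟨r, rfl⟩
    · exact .inr (.inl h)
    · exact .inr (.inr ((hM.lt_iff_exists _ _).2 ⟨r, by rw [hM.zero_add]⟩))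
  · rcases h with h | h | h
    · exact .inl ((hM.lt_succ _ _).2 (.inl h))
    · exact .inl ((hM.lt_succ _ _).2 (.inr h))
    · obtain ⟨r, rfl⟩ := (hM.lt_iff_exists _ _).1 h
      rcases hM.eq_zero_or_succ r with rfl | ⟨r, rfl⟩
      · rw [hM.add_zero]; exact .inr (.inl rfl)
      · refine .inr (.inr ((hM.lt_iff_exists _ _).2 ⟨r, ?_⟩))
        rw [hM.add_succ, hM.succ_add n r]

theorem lt_irrefl (hM : RCA0 M) (m : M) : ¬ m < m := by
  rw [hM.lt_iff_exists]
  rintro ⟨r, h⟩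
  have : 0 + m = r + 1 + m := by rw [hM.zero_add, hM.add_comm, ← hM.add_assoc]; exact h
  exact hM.succ_ne_zero r (hM.add_right_cancel this).symm

theorem lt_trans (hM : RCA0 M) {a b c : M} (h : a < b) (h' : b < c) : a < c := by
  rw [hM.lt_iff_exists] at *
  obtain ⟨r, rfl⟩ := h
  obtain ⟨s, rfl⟩ := h'
  exact ⟨r + 1 + s, by rw [← hM.add_assoc, ← hM.add_assoc]⟩

end RCA0

/-! ### Models of `RCA₀` as ordered semirings -/

variable {M : Type*} [L2Structure M] [hM : Fact (RCA0 M)]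

instance : CommSemiring M where
  toZero := L2Structure.toZero
  toOne := L2Structure.toOne
  toAdd := L2Structure.toAdd
  toMul := L2Structure.toMul
  add_assoc := hM.out.add_assoc
  zero_add := hM.out.zero_add
  add_zero := hM.out.add_zero
  add_comm := hM.out.add_comm
  mul_assoc := hM.out.mul_assoc
  mul_comm := hM.out.mul_comm
  zero_mul := hM.out.zero_mul
  mul_zero := hM.out.mul_zero
  one_mul a := (hM.out.mul_comm 1 a).trans (hM.out.mul_one a)
  mul_one := hM.out.mul_one
  left_distrib := hM.out.mul_add
  right_distrib a b c := by
    rw [hM.out.mul_comm, hM.out.mul_add, hM.out.mul_comm c, hM.out.mul_comm c]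
  nsmul := nsmulRec
  npow := npowRec

noncomputable instance : LinearOrder M where
  toLT := L2Structure.toLT
  le a b := a < b ∨ a = b
  le_refl _ := .inr rfl
  le_trans a b c := by
    rintro (h | rfl) (h' | rfl)
    exacts [.inl (hM.out.lt_trans h h'), .inl h, .inl h', .inr rfl]
  le_antisymm a b := by
    rintro (h | rfl) (h' | h')
    exacts [(hM.out.lt_irrefl _ (hM.out.lt_trans h h')).elim, h'.symm, rfl, rfl]
  lt_iff_le_not_ge a b := by
    constructor
    · refine fun h => ⟨.inl h, ?_⟩
      rintro (h' | rfl)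
      exacts [hM.out.lt_irrefl _ (hM.out.lt_trans h h'), hM.out.lt_irrefl _ h]
    · rintro ⟨h | rfl, h'⟩
      exacts [h, (h' (.inr rfl)).elim]
  le_total a b := by
    rcases hM.out.lt_trichotomy a b with h | h | h
    exacts [.inl (.inl h), .inl (.inr h), .inr (.inl h)]
  toDecidableLE := Classical.decRel _

theorem le_iff_exists_add {a b : M} : a ≤ b ↔ ∃ r, b = a + r :=
  hM.out.le_iff_exists a b

instance : IsOrderedAddMonoid M where
  add_le_add_left a b h c := by
    obtain ⟨r, rfl⟩ := le_iff_exists_add.1 h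
    exact le_iff_exists_add.2 ⟨r, by ring⟩

instance : CanonicallyOrderedAdd M where
  le_add_self a b := le_iff_exists_add.2 ⟨b, by ring⟩
  le_self_add a b := le_iff_exists_add.2 ⟨b, by ring⟩
  exists_add_of_le h := le_iff_exists_add.1 h

instance : IsOrderedCancelAddMonoid M where
  le_of_add_le_add_left a b c h := by
    obtain ⟨r, h⟩ := le_iff_exists_add.1 h
    exact le_iff_exists_add.2 ⟨r, hM.out.add_right_cancel (c := a) (by rw [add_comm c, h]; ring)⟩

instance : Nontrivial M := ⟨⟨1, 0, fun h => hM.out.succ_ne_zero 0 (by rw [zero_add]; exact h)⟩⟩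

theorem lt_succ_iff {a b : M} : a < b + 1 ↔ a ≤ b := hM.out.lt_succ a b

theorem succ_le_iff {a b : M} : a + 1 ≤ b ↔ a < b := by
  rw [← lt_succ_iff, add_lt_add_iff_right]

theorem mul_lt_mul_of_lt {a b c : M} (h : b < c) (ha : 0 < a) : a * b < a * c := by
  obtain ⟨r, rfl⟩ := le_iff_exists_add.1 (succ_le_iff.2 h)
  obtain ⟨s, rfl⟩ := le_iff_exists_add.1 (succ_le_iff.2 ha)
  have : (0 + 1 + s) * (b + 1 + r) = (0 + 1 + s) * b + (s + r + s * r) + 1 := by ring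
  rw [this]
  exact lt_succ_iff.2 le_self_add

instance : IsStrictOrderedRing M where
  zero_le_one := zero_le
  mul_lt_mul_of_pos_left _ ha _ _ h := mul_lt_mul_of_lt h ha
  mul_lt_mul_of_pos_right a ha b c h := by
    rw [mul_comm b, mul_comm c]; exact mul_lt_mul_of_lt h ha

instance Bd.le (s t : (ℕ → M) → M) [Tm s] [Tm t] : Bd fun v => s v ≤ t v :=
  inferInstanceAs (Bd fun v => s v < t v ∨ s v = t v)

theorem sigma_induction (P : M → M → Prop) [Bd fun v : ℕ → M => P (v 0) (v 1)]
    (h0 : ∃ m, P 0 m) (hs : ∀ n, (∃ m, P n m) → ∃ m, P (n + 1) m) (n : M) : ∃ m, P n m :=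
  hM.out.sigma_induction P h0 hs n

theorem bdd_induction (P : M → Prop) [Bd fun v : ℕ → M => P (v 0)]
    (h0 : P 0) (hs : ∀ n, P n → P (n + 1)) (n : M) : P n :=
  hM.out.induction P h0 hs n

theorem exists_least (P : M → Prop) [Bd fun v : ℕ → M => P (v 0)] (h : ∃ n, P n) :
    ∃ n, P n ∧ ∀ m, m < n → ¬ P m := by
  by_contra! hc
  obtain ⟨n, hn⟩ := h
  have : ∀ n : M, ∀ m, m < n → ¬ P m := bdd_induction _ (fun m hm => (not_lt_zero hm).elim)
    fun n ih m hm hP => by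
      rcases (lt_succ_iff.1 hm).lt_or_eq with h | rfl
      · exact ih m h hP
      · obtain ⟨m, hm, hP⟩ := hc m hP
        exact ih m hm hP
  exact this (n + 1) n (lt_succ_iff.2 le_rfl) hn

end Arithmetic

/-! ### Pairs, divisibility and codes of finite sets -/

section Coding

variable {M : Type*} [L2Structure M] [hM : Fact (RCA0 M)]

instance Tm.pair (s t : (ℕ → M) → M) [Tm s] [Tm t] : Tm fun v => pair (s v) (t v) :=
  inferInstanceAs (Tm fun v => (s v + t v) * (s v + t v) + s v)

theorem le_mul_self_of_arith (a : M) : a ≤ a * a := by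
  rcases eq_or_ne a 0 with rfl | h
  · simp
  · exact le_mul_of_one_le_right zero_le (by simpa using succ_le_iff.2 (pos_iff_ne_zero.2 h))

theorem left_le_pair (i j : M) : i ≤ pair i j := le_add_self

theorem right_le_pair (i j : M) : j ≤ pair i j :=
  le_add_self.trans ((le_mul_self_of_arith (i + j)).trans le_self_add)

/-- Since `i ≤ i + j`, the code lies below the next square `(i + j + 1)²`. -/
theorem pair_lt_pair {i j i' j' : M} (h : i + j < i' + j') : pair i j < pair i' j' := by
  obtain ⟨r, hr⟩ := le_iff_exists_add.1 (succ_le_iff.2 h)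
  have : pair i' j' = pair i j + (j + (i + j) + (r * r + r * (i + j + 1) + r * (i + j + 1)) + i')
      + 1 := by
    simp only [pair, hr]; ring
  rw [this]
  exact lt_succ_iff.2 le_self_add

theorem pair_inj {i j i' j' : M} : pair i j = pair i' j' ↔ i = i' ∧ j = j' := by
  refine ⟨fun h => ?_, fun ⟨h, h'⟩ => by rw [h, h']⟩
  rcases lt_trichotomy (i + j) (i' + j') with hlt | he | hlt
  · exact absurd h (pair_lt_pair hlt).ne
  · have hi : i = i' := by simpa [pair, he] using h
    subst hi
    exact ⟨rfl, add_left_cancel he⟩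
  · exact absurd h (pair_lt_pair hlt).ne'

theorem dvd_iff_bdd (a b : M) : a ∣ b ↔ ∃ q, q < b + 1 ∧ b = a * q := by
  refine ⟨fun ⟨q, h⟩ => ?_, fun ⟨q, _, h⟩ => ⟨q, h⟩⟩
  rcases eq_or_ne a 0 with rfl | ha
  · exact ⟨0, lt_succ_iff.2 zero_le, by simpa using h⟩
  · refine ⟨q, lt_succ_iff.2 ?_, h⟩
    rw [h]
    exact le_mul_of_one_le_left zero_le (by simpa using succ_le_iff.2 (pos_iff_ne_zero.2 ha))

instance Bd.dvd (s t : (ℕ → M) → M) [Tm s] [Tm t] : Bd fun v => s v ∣ t v :=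
  .congr (P := fun v => ∃ q, q < t v + 1 ∧ t v = s v * q) fun _ => dvd_iff_bdd _ _

theorem dvd_of_dvd_add {a u v : M} (h : a ∣ u + v) (hu : a ∣ u) : a ∣ v := by
  obtain ⟨s, rfl⟩ := hu
  obtain ⟨t, ht⟩ := h
  rcases eq_or_ne a 0 with rfl | ha
  · simp only [zero_mul, zero_add] at ht; simp [ht]
  · have : s ≤ t := by
      by_contra! hlt
      exact (mul_lt_mul_of_lt hlt (pos_iff_ne_zero.2 ha)).not_ge (ht ▸ le_self_add)
    obtain ⟨r, rfl⟩ := le_iff_exists_add.1 this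
    rw [mul_add] at ht
    exact ⟨r, add_left_cancel ht⟩

/-- The modulus `m (i + 1) + 1`. -/
def modulus (m i : M) : M := m * (i + 1) + 1

instance Tm.modulus (s t : (ℕ → M) → M) [Tm s] [Tm t] : Tm fun v => modulus (s v) (t v) :=
  inferInstanceAs (Tm fun v => s v * (t v + 1) + 1)

/-- The combination `(j + 1) · modulus m i - (i + 1) · modulus m j` equals `j - i`, so `modulus m j`
divides `|i - j| · x`. As `|i - j|` divides `m` and `m (j + 1)` is `-1` modulo `modulus m j`, the
factor can be cancelled. -/
theorem modulus_euclid {k m i j x : M} (hm : ∀ d, d < k → d + 1 ∣ m) (hi : i < k) (hj : j < k)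
    (hij : i ≠ j) (h : modulus m j ∣ modulus m i * x) : modulus m j ∣ x := by
  have key : ∀ d, d ∣ m → modulus m j ∣ d * x → modulus m j ∣ x := by
    rintro d ⟨e, rfl⟩ hd
    have : modulus (d * e) j ∣ d * x * (e * (j + 1)) + x :=
      ⟨x, by simp only [modulus]; ring⟩
    exact dvd_of_dvd_add this (hd.mul_right _)
  rcases lt_or_gt_of_ne hij with hlt | hlt
  · obtain ⟨r, rfl⟩ := le_iff_exists_add.1 (succ_le_iff.2 hlt)
    refine key (r + 1) (hm r (lt_of_le_of_lt le_add_self hj)) ?_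
    refine dvd_of_dvd_add (u := modulus m (i + 1 + r) * ((i + 1) * x)) ?_ (dvd_mul_right _ _)
    have : modulus m (i + 1 + r) * ((i + 1) * x) + (r + 1) * x
        = modulus m i * x * (i + 1 + r + 1) := by simp only [modulus]; ring
    rw [this]
    exact h.mul_right _
  · obtain ⟨r, rfl⟩ := le_iff_exists_add.1 (succ_le_iff.2 hlt)
    refine key (r + 1) (hm r (lt_of_le_of_lt le_add_self hi)) ?_
    refine dvd_of_dvd_add (u := modulus m (j + 1 + r) * x * (j + 1)) ?_ (h.mul_right _)
    exact ⟨(j + 1 + r + 1) * x, by simp only [modulus]; ring⟩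

theorem exists_common_multiple (k : M) : ∃ m, 0 < m ∧ ∀ d, d < k → d + 1 ∣ m := by
  refine sigma_induction (fun k m : M => 0 < m ∧ ∀ d, d < k → d + 1 ∣ m)
    ⟨1, zero_lt_one, fun d hd => (not_lt_zero hd).elim⟩ (fun n ⟨m, hm, h⟩ => ?_) k
  refine ⟨m * (n + 1), mul_pos hm (lt_succ_iff.2 zero_le), fun d hd => ?_⟩
  rcases (lt_succ_iff.1 hd).lt_or_eq with hd | rfl
  exacts [(h d hd).mul_right _, dvd_mul_left _ _]

theorem modulus_pos (m i : M) : 0 < modulus m i := lt_succ_iff.2 zero_le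

theorem one_lt_modulus {m : M} (hm : 0 < m) (i : M) : 1 < modulus m i := by
  have : 0 < m * (i + 1) := mul_pos hm (lt_succ_iff.2 zero_le)
  simpa [modulus] using this

theorem modulus_not_dvd_one {m : M} (hm : 0 < m) (i : M) : ¬ modulus m i ∣ 1 := by
  rintro ⟨q, h⟩
  rcases eq_or_ne q 0 with rfl | hq
  · simp at h
  · have : modulus m i ≤ modulus m i * q :=
      le_mul_of_one_le_right zero_le (by simpa using succ_le_iff.2 (pos_iff_ne_zero.2 hq))
    exact (h ▸ this).not_gt (one_lt_modulus hm i)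

/-- The witness is the product of the moduli of the elements of `X` below `k`, built by `Σ⁰₁`
induction, one factor at a time. -/
theorem exists_modulus_dvd_iff {k m : M} (hm0 : 0 < m) (hm : ∀ d, d < k → d + 1 ∣ m)
    (X : Set M) [Fact (X ∈ L2Structure.sets)] :
    ∃ n, 0 < n ∧ ∀ i, i < k → (modulus m i ∣ n ↔ i ∈ X) := by
  have (t : M) : ∃ n, 0 < n ∧ (t ≤ k → ∀ i, i < k → (modulus m i ∣ n ↔ i ∈ X ∧ i < t)) := by
    refine sigma_induction (fun t n : M => 0 < n ∧ (t ≤ k → ∀ i, i < k →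
      (modulus m i ∣ n ↔ i ∈ X ∧ i < t))) ?_ (fun t ⟨n, hn, ih⟩ => ?_) t
    · exact ⟨1, zero_lt_one, fun _ i _ =>
        iff_of_false (modulus_not_dvd_one hm0 i) fun h => not_lt_zero h.2⟩
    · by_cases ht : t ∈ X
      · refine ⟨modulus m t * n, mul_pos (modulus_pos m t) hn, fun htk i hi => ?_⟩
        rw [succ_le_iff] at htk
        rw [lt_succ_iff, le_iff_lt_or_eq]
        by_cases hit : i = t
        · subst hit; simp [ht]
        · have : modulus m i ∣ modulus m t * n ↔ modulus m i ∣ n :=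
            ⟨modulus_euclid hm htk hi (Ne.symm hit), fun h => h.mul_left _⟩
          rw [this, ih htk.le i hi]
          simp [hit]
      · refine ⟨n, hn, fun htk i hi => ?_⟩
        rw [succ_le_iff] at htk
        rw [ih htk.le i hi, lt_succ_iff, le_iff_lt_or_eq]
        refine and_congr_right fun hiX => ?_
        have : i ≠ t := fun h => ht (h ▸ hiX)
        simp [this]
  obtain ⟨n, hn, h⟩ := this k
  exact ⟨n, hn, fun i hi => by rw [h le_rfl i hi]; simp [hi]⟩

theorem finRep_iff (c : M) : FinRep c ↔ ∃ k, k < c + 1 ∧ ∃ m, m < c + 1 ∧ ∃ n, n < c + 1 ∧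
    c = pair (pair k m) n := by
  constructor
  · rintro ⟨k, m, n, rfl⟩
    exact ⟨k, lt_succ_iff.2 ((left_le_pair _ _).trans (left_le_pair _ _)),
      m, lt_succ_iff.2 ((right_le_pair _ _).trans (left_le_pair _ _)),
      n, lt_succ_iff.2 (right_le_pair _ _), rfl⟩
  · rintro ⟨k, _, m, _, n, _, h⟩
    exact ⟨k, m, n, h⟩

theorem finMem_pair {i k m n : M} : FinMem i (pair (pair k m) n) ↔ i < k ∧ modulus m i ∣ n := by
  constructor
  · rintro ⟨k', m', n', h, hi, hd⟩
    obtain ⟨h', rfl⟩ := pair_inj.1 h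
    obtain ⟨rfl, rfl⟩ := pair_inj.1 h'
    exact ⟨hi, hd⟩
  · exact fun ⟨hi, hd⟩ => ⟨k, m, n, rfl, hi, hd⟩

theorem finMem_iff (i c : M) : FinMem i c ↔ ∃ k, k < c + 1 ∧ ∃ m, m < c + 1 ∧ ∃ n, n < c + 1 ∧
    c = pair (pair k m) n ∧ i < k ∧ modulus m i ∣ n := by
  constructor
  · rintro ⟨k, m, n, rfl, h⟩
    exact ⟨k, lt_succ_iff.2 ((left_le_pair _ _).trans (left_le_pair _ _)),
      m, lt_succ_iff.2 ((right_le_pair _ _).trans (left_le_pair _ _)),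
      n, lt_succ_iff.2 (right_le_pair _ _), rfl, h⟩
  · rintro ⟨k, _, m, _, n, _, h⟩
    exact ⟨k, m, n, h⟩

theorem FinMem.lt {i c : M} (h : FinMem i c) : i < c := by
  obtain ⟨k, m, n, rfl, h, _⟩ := h
  exact h.trans_le ((left_le_pair _ _).trans (left_le_pair _ _))

instance Bd.finRep (t : (ℕ → M) → M) [Tm t] : Bd fun v => FinRep (t v) :=
  .congr fun _ => finRep_iff _

instance Bd.finMem (s t : (ℕ → M) → M) [Tm s] [Tm t] : Bd fun v => FinMem (s v) (t v) :=
  .congr fun _ => finMem_iff _ _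

theorem isFinCode_iff (c : M) : IsFinCode c ↔ FinRep c ∧ ∀ d, d < c → FinRep d →
    ¬ ∀ i, i < c → (FinMem i d ↔ FinMem i c) := by
  refine and_congr_right fun _ => forall₂_congr fun d hd => imp_congr_right fun _ => not_congr ?_
  refine ⟨fun h i _ => h i, fun h i => ?_⟩
  by_cases hi : i < c
  · exact h i hi
  · exact iff_of_false (fun h => hi (h.lt.trans hd)) fun h => hi h.lt

instance Bd.isFinCode (t : (ℕ → M) → M) [Tm t] : Bd fun v => IsFinCode (t v) :=
  .congr fun _ => isFinCode_iff _

theorem IsFinCode.ext {c d : M} (hc : IsFinCode c) (hd : IsFinCode d)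
    (h : ∀ i, FinMem i c ↔ FinMem i d) : c = d := by
  rcases lt_trichotomy c d with hlt | he | hlt
  · exact (hd.2 c hlt hc.1 h).elim
  · exact he
  · exact (hc.2 d hlt hd.1 fun i => (h i).symm).elim

theorem exists_finCode (X : Set M) [Fact (X ∈ L2Structure.sets)] (b : M) (hb : ∀ i ∈ X, i < b) :
    ∃ c, IsFinCode c ∧ ∀ i, FinMem i c ↔ i ∈ X := by
  obtain ⟨m, hm0, hm⟩ := exists_common_multiple b
  obtain ⟨n, -, hn⟩ := exists_modulus_dvd_iff hm0 hm X
  have h (i : M) : FinMem i (pair (pair b m) n) ↔ i ∈ X := by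
    rw [finMem_pair]
    exact ⟨fun h => (hn i h.1).1 h.2, fun h => ⟨hb i h, (hn i (hb i h)).2 h⟩⟩
  -- Members of a set are smaller than any number representing it, so comparing members below the
  -- sum of the two numbers suffices and keeps the condition bounded.
  obtain ⟨c, ⟨hc, hX⟩, hmin⟩ := exists_least
    (fun c => FinRep c ∧ ∀ i, i < c + pair (pair b m) n →
      (FinMem i c ↔ FinMem i (pair (pair b m) n))) ⟨_, ⟨b, m, n, rfl⟩, fun _ _ => Iff.rfl⟩
  have hX (i : M) : FinMem i c ↔ i ∈ X := by
    rw [← h]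
    by_cases hi : i < c + pair (pair b m) n
    · exact hX i hi
    · exact iff_of_false (fun h => hi (h.lt.trans_le le_self_add))
        fun h => hi (h.lt.trans_le le_add_self)
  refine ⟨c, ⟨hc, fun d hdc hd hdX => hmin d hdc ⟨hd, fun i _ => ?_⟩⟩, hX⟩
  rw [hdX, hX, h]

instance Fact.setOf (P : M → Prop) [Bd fun v : ℕ → M => P (v 0)] :
    Fact ({n | P n} ∈ (L2Structure.sets : Set (Set M))) :=
  ⟨hM.out.comprehension P⟩

end Coding

/-! ### Functions and collection -/

section Functions

variable {M : Type*} [L2Structure M] [hM : Fact (RCA0 M)]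

/-- Collection for bounded formulas. The hypothesis `hP` quantifies over terms because `P` is used
at several variable positions and instance search cannot substitute into an arbitrary `Bd`
predicate. -/
theorem exists_bound (P : M → M → Prop)
    (hP : ∀ s t : (ℕ → M) → M, [Tm s] → [Tm t] → Bd fun v => P (s v) (t v)) (k : M)
    (h : ∀ n, n < k → ∃ m, P n m) : ∃ b, ∀ n, n < k → ∃ m, m < b ∧ P n m := by
  have (t : M) : ∃ b, t ≤ k → ∀ n, n < t → ∃ m, m < b ∧ P n m := by
    refine sigma_induction (fun t b : M => t ≤ k → ∀ n, n < t → ∃ m, m < b ∧ P n m)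
      ⟨0, fun _ n hn => (not_lt_zero hn).elim⟩ (fun t ⟨b, hb⟩ => ?_) t
    by_cases ht : t < k
    · obtain ⟨m, hm⟩ := h t ht
      refine ⟨b + (m + 1), fun _ n hn => ?_⟩
      rcases (lt_succ_iff.1 hn).lt_or_eq with hn | rfl
      · obtain ⟨m', hm', hP⟩ := hb ht.le n hn
        exact ⟨m', hm'.trans_le le_self_add, hP⟩
      · exact ⟨m, (lt_succ_iff.2 le_rfl).trans_le le_add_self, hm⟩
    · exact ⟨0, fun h => (ht (succ_le_iff.1 h)).elim⟩
  obtain ⟨b, hb⟩ := this k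
  exact ⟨b, hb le_rfl⟩

theorem Func.apply_eq_iff {M : Type*} [L2Structure M] (F : Func M) (x y : M) :
    F x = y ↔ pair x y ∈ F.graph := by
  have h := (F.total x).exists.choose_spec
  exact ⟨fun e => e ▸ h, fun h' => (F.total x).unique h h'⟩

instance Bd.apply_eq (F : Func M) (s t : (ℕ → M) → M) [Tm s] [Tm t] :
    Bd fun v => F (s v) = t v :=
  have : Fact (F.graph ∈ L2Structure.sets) := ⟨F.graph_mem⟩
  .congr fun _ => F.apply_eq_iff _ _

/-- The function with a given bounded-quantifier graph. -/
def Func.ofRel (P : M → M → Prop)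
    (hP : ∀ s t : (ℕ → M) → M, [Tm s] → [Tm t] → Bd fun v => P (s v) (t v))
    (h : ∀ x, ∃! y, P x y) : Func M where
  graph := {p | ∃ x, x < p + 1 ∧ ∃ y, y < p + 1 ∧ p = pair x y ∧ P x y}
  graph_mem := Fact.out
  isPair := fun p ⟨x, _, y, _, hp, _⟩ => ⟨x, y, hp⟩
  total x := by
    refine (existsUnique_congr fun y => ?_).2 (h x)
    constructor
    · rintro ⟨x', _, y', _, hp, h⟩
      obtain ⟨rfl, rfl⟩ := pair_inj.1 hp
      exact h
    · exact fun h => ⟨x, lt_succ_iff.2 (left_le_pair _ _), y, lt_succ_iff.2 (right_le_pair _ _),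
        rfl, h⟩

theorem Func.ofRel_apply (P : M → M → Prop)
    (hP : ∀ s t : (ℕ → M) → M, [Tm s] → [Tm t] → Bd fun v => P (s v) (t v))
    (h : ∀ x, ∃! y, P x y) (x : M) : P x (Func.ofRel P hP h x) := by
  obtain ⟨x', _, y', _, hp, h⟩ := ((Func.ofRel P hP h).apply_eq_iff x _).1 rfl
  obtain ⟨rfl, h'⟩ := pair_inj.1 hp
  exact h' ▸ h

end Functions

/-! ### Parity graphs -/

section ParityGraphs

variable {M : Type*} [L2Structure M] [hM : Fact (RCA0 M)]

/-- `e` is one of the edges `(n, ↓, n)` and `(x, ⇓, x)` for `x < n`. -/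
def ParityEdge (n e : M) : Prop :=
  (∃ x, x < n ∧ e = pair (pair x 1) x) ∨ e = pair (pair n 0) n

instance Bd.parityEdge (s t : (ℕ → M) → M) [Tm s] [Tm t] : Bd fun v => ParityEdge (s v) (t v) := by
  unfold ParityEdge; infer_instance

theorem pair_le_pair {i j i' j' : M} (hi : i ≤ i') (hj : j ≤ j') : pair i j ≤ pair i' j' := by
  unfold pair; gcongr

theorem ParityEdge.lt {n e : M} (h : ParityEdge n e) : e < pair (pair n 1) n + 1 := by
  rw [lt_succ_iff]
  rcases h with ⟨x, hx, rfl⟩ | rfl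
  · exact pair_le_pair (pair_le_pair hx.le le_rfl) hx.le
  · exact pair_le_pair (pair_le_pair le_rfl zero_le) le_rfl

theorem parityEdge_edge {n x y : M} {r : Label} : ParityEdge n (edge x r y) ↔
    x = y ∧ (r = .weak ∧ x < n ∨ r = .down ∧ x = n) := by
  have h01 : (0 : M) ≠ 1 := zero_ne_one
  cases r
  · simp only [ParityEdge, edge, Label.code, pair_inj]
    grind
  · simp only [ParityEdge, edge, Label.code, pair_inj]
    grind

theorem exists_parityCode (n : M) : ∃ c, IsFinCode c ∧ ∀ e, FinMem e c ↔ ParityEdge n e :=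
  exists_finCode {e | ParityEdge n e} _ fun _ => ParityEdge.lt

/-- The code of the edge set of the `n`-th parity graph. -/
noncomputable def parityCode (n : M) : M := (exists_parityCode n).choose

theorem isFinCode_parityCode (n : M) : IsFinCode (parityCode n) :=
  (exists_parityCode n).choose_spec.1

theorem finMem_parityCode {n e : M} : FinMem e (parityCode n) ↔ ParityEdge n e :=
  (exists_parityCode n).choose_spec.2 e

/-- Although the code is obtained by choice, codes are least representatives, so it is determined by
its members and has a bounded graph. -/
instance Bd.parityCode_eq (s t : (ℕ → M) → M) [Tm s] [Tm t] :
    Bd fun v => parityCode (s v) = t v :=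
  .congr (P := fun v => IsFinCode (t v) ∧ (∀ e, e < t v → FinMem e (t v) → ParityEdge (s v) e) ∧
    (∀ x, x < s v → FinMem (pair (pair x 1) x) (t v)) ∧ FinMem (pair (pair (s v) 0) (s v)) (t v))
    fun v => by
      constructor
      · rintro h
        rw [← h]
        exact ⟨isFinCode_parityCode _, fun e _ => finMem_parityCode.1,
          fun x hx => finMem_parityCode.2 (.inl ⟨x, hx, rfl⟩), finMem_parityCode.2 (.inr rfl)⟩
      · rintro ⟨h, h₁, h₂, h₃⟩
        refine (isFinCode_parityCode _).ext h fun e => ?_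
        rw [finMem_parityCode]
        refine ⟨?_, fun he => h₁ e he.lt he⟩
        rintro (⟨x, hx, rfl⟩ | rfl)
        exacts [h₂ x hx, h₃]

/-- The size-change graph with parameters `x < K` and arcs `(n, ↓, n)` and `(x, ⇓, x)` for
`x < n`. -/
noncomputable def parityGraph (K n : M) (hn : n < K) : SCGraph M where
  src := ⟨0, K⟩
  tgt := ⟨0, K⟩
  edges := parityCode n
  edges_isFinCode := isFinCode_parityCode n
  edges_sub e he := by
    rcases finMem_parityCode.1 he with ⟨x, hx, rfl⟩ | rfl
    · exact ⟨x, .weak, x, hx.trans hn, hx.trans hn, rfl⟩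
    · exact ⟨n, .down, n, hn, hn, rfl⟩
  edges_unique x r r' y h h' := by
    rw [finMem_parityCode, parityEdge_edge] at h h'
    rcases h with ⟨-, ⟨rfl, h⟩ | ⟨rfl, h⟩⟩ <;> rcases h' with ⟨-, ⟨rfl, h'⟩ | ⟨rfl, h'⟩⟩
    exacts [rfl, (h.ne h').elim, (h'.ne h).elim, rfl]

theorem parityGraph_arc {K n x y : M} {r : Label} (hn : n < K) : (parityGraph K n hn).Arc x r y ↔
    x = y ∧ (r = .weak ∧ x < n ∨ r = .down ∧ x = n) :=
  finMem_parityCode.trans parityEdge_edge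

theorem FunId.code_injective : Function.Injective (FunId.code (M := M)) := by
  intro f g h
  obtain ⟨h₁, h₂⟩ := pair_inj.1 h
  exact FunId.ext h₁ h₂

theorem SCGraph.code_injective : Function.Injective (SCGraph.code (M := M)) := by
  rintro ⟨s, t, e, _, _, _⟩ ⟨s', t', e', _, _, _⟩ h
  obtain ⟨h₁, h₂⟩ := pair_inj.1 h
  obtain ⟨h₁, h₃⟩ := pair_inj.1 h₁
  obtain rfl := FunId.code_injective h₁
  obtain rfl := FunId.code_injective h₃
  obtain rfl : e = e' := h₂
  rfl

theorem SCGraph.ext_arc {G H : SCGraph M} (hs : G.src = H.src) (ht : G.tgt = H.tgt)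
    (h : ∀ x r y, G.Arc x r y ↔ H.Arc x r y) : G = H := by
  refine SCGraph.code_injective ?_
  have : G.edges = H.edges := by
    refine G.edges_isFinCode.ext H.edges_isFinCode fun e => ⟨fun he => ?_, fun he => ?_⟩
    · obtain ⟨x, r, y, -, -, rfl⟩ := G.edges_sub e he
      exact (h x r y).1 he
    · obtain ⟨x, r, y, -, -, rfl⟩ := H.edges_sub e he
      exact (h x r y).2 he
  rw [code, code, hs, ht, this]

/-- Only loops compose: there is one at `x` iff `x ≤ a` and `x ≤ b`, and it is strict iff `x` equals
`a` or `b`, that is, iff `x` is the minimum. -/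
theorem IsComp.eq_parityGraph {K a b : M} {ha : a < K} {hb : b < K} {H : SCGraph M}
    (h : IsComp (parityGraph K a ha) (parityGraph K b hb) H) :
    H = parityGraph K (min a b) (min_lt_of_left_lt ha) := by
  obtain ⟨-, hs, ht, hd, hw⟩ := h
  refine SCGraph.ext_arc hs ht fun x r z => ?_
  simp only [parityGraph_arc] at hd hw ⊢
  cases r
  · rw [hd]
    constructor
    · rintro ⟨y, -, r, h⟩
      grind
    · rintro ⟨rfl, h⟩
      refine ⟨x, ?_, ?_⟩
      · change x < K
        grind
      · by_cases hxa : x = a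
        · by_cases hxb : x = b
          · exact ⟨.down, by grind⟩
          · exact ⟨.weak, by grind⟩
        · exact ⟨.weak, by grind⟩
  · rw [hw]
    constructor
    · rintro ⟨⟨y, -, h⟩, -⟩
      grind
    · rintro ⟨rfl, h⟩
      refine ⟨⟨x, ?_, ?_⟩, ?_⟩
      · change x < K
        grind
      · grind
      · grind

/-- The set of the codes of all parity graphs with parameters `x < K`. -/
def parityGraphs (K : M) : Set M := {a | ∃ n, n < K ∧ ∃ e, e < a + 1 ∧ parityCode n = e ∧
  a = pair (pair (pair 0 K) (pair 0 K)) e}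

theorem mem_parityGraphs {K a : M} :
    a ∈ parityGraphs K ↔ ∃ n, ∃ hn : n < K, a = (parityGraph K n hn).code := by
  constructor
  · rintro ⟨n, hn, e, -, rfl, rfl⟩
    exact ⟨n, hn, rfl⟩
  · rintro ⟨n, hn, rfl⟩
    exact ⟨n, hn, _, lt_succ_iff.2 (right_le_pair _ _), rfl, rfl⟩

theorem parityGraphs_mem_sets (K : M) : parityGraphs K ∈ (L2Structure.sets : Set (Set M)) :=
  (Fact.setOf fun a => ∃ n, n < K ∧ ∃ e, e < a + 1 ∧ parityCode n = e ∧
    a = pair (pair (pair 0 K) (pair 0 K)) e).out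

theorem isFinGraphSet_parityGraphs (K : M) : IsFinGraphSet (parityGraphs K) := by
  refine ⟨parityGraphs_mem_sets K, ?_, fun a ha => ?_⟩
  -- With `K` possibly nonstandard, a common bound on the edge codes takes collection.
  · obtain ⟨b, hb⟩ := exists_bound (fun n e : M => parityCode n = e)
      (fun _ _ _ _ => inferInstance) K fun n _ => ⟨_, rfl⟩
    refine ⟨pair (pair (pair 0 K) (pair 0 K)) b + 1, ?_⟩
    rintro _ ⟨n, hn, e, -, rfl, rfl⟩
    obtain ⟨_, he, rfl⟩ := hb n hn
    exact lt_succ_iff.2 (pair_le_pair le_rfl he.le)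
  · obtain ⟨n, hn, h⟩ := mem_parityGraphs.1 ha
    exact ⟨_, h⟩

theorem InClosure.exists_eq_parityGraph {K : M} {G : SCGraph M}
    (h : InClosure (parityGraphs K) G) : ∃ n, ∃ hn : n < K, G = parityGraph K n hn := by
  -- The family itself is a closed set of the model, so it can be the test set for the closure.
  have := h _ (parityGraphs_mem_sets K) subset_rfl fun G₀ G₁ H h₀ h₁ hH => by
    obtain ⟨a, ha, h₀⟩ := mem_parityGraphs.1 h₀
    obtain ⟨b, hb, h₁⟩ := mem_parityGraphs.1 h₁
    obtain rfl := SCGraph.code_injective h₀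
    obtain rfl := SCGraph.code_injective h₁
    exact mem_parityGraphs.2 ⟨_, _, congrArg _ hH.eq_parityGraph⟩
  obtain ⟨n, hn, h⟩ := mem_parityGraphs.1 this
  exact ⟨n, hn, SCGraph.code_injective h⟩

theorem SCTCriterion.isSCT_parityGraphs (h : SCTCriterion M) (K : M) : IsSCT (parityGraphs K) := by
  refine (h _ (isFinGraphSet_parityGraphs K)).2 fun G hG _ => ?_
  obtain ⟨n, hn, rfl⟩ := hG.exists_eq_parityGraph
  exact ⟨n, (parityGraph_arc hn).2 ⟨rfl, .inr ⟨rfl, rfl⟩⟩⟩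

/-- Every bounded function takes a value that is taken infinitely often and is eventually a lower
bound. -/
theorem SCTCriterion.exists_liminf (h : SCTCriterion M) (K : M) (d : Func M) (hd : ∀ s, d s < K) :
    ∃ n, (InfMany fun s => d s = n) ∧ ∃ t, ∀ j, n ≤ d (t + j) := by
  have hP (s : M) : ∃! a : M, ∃ n, n < K ∧ d s = n ∧ ∃ e, e < a + 1 ∧
      parityCode n = e ∧ a = pair (pair (pair 0 K) (pair 0 K)) e := by
    refine ⟨_, ⟨_, hd s, rfl, _, lt_succ_iff.2 (right_le_pair _ _), rfl, rfl⟩, ?_⟩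
    rintro a ⟨n, hn, rfl, e, -, rfl, rfl⟩
    rfl
  let π : Func M := .ofRel _ (fun _ _ _ _ => inferInstance) hP
  have hπ (s : M) : π s = (parityGraph K (d s) (hd s)).code := by
    obtain ⟨n, hn, h, e, -, rfl, he⟩ := Func.ofRel_apply _ (fun _ _ _ _ => inferInstance) hP s
    subst h
    exact he
  have harc {s x y : M} {r : Label} (h : ArcAt π s x r y) :
      x = y ∧ (r = .weak ∧ x < d s ∨ r = .down ∧ x = d s) := by
    obtain ⟨G, hG, h⟩ := h
    obtain rfl := SCGraph.code_injective ((hπ s).symm.trans hG)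
    exact (parityGraph_arc _).1 h
  obtain ⟨t, θ, hθ, hinf⟩ := h.isSCT_parityGraphs K π (fun n => ⟨_, _, hπ n, hπ (n + 1), rfl⟩)
    fun n => mem_parityGraphs.2 ⟨_, _, hπ n⟩
  -- All arcs are loops, so the thread never changes its parameter.
  have hconst (j : M) : θ j = θ 0 := by
    refine bdd_induction (fun j : M => θ j = θ 0) rfl (fun j ih => ?_) j
    obtain ⟨r, hr⟩ := hθ j
    exact (harc hr).1.symm.trans ih
  refine ⟨θ 0, fun N => ?_, t, fun j => ?_⟩
  · obtain ⟨j, hj, h⟩ := hinf N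
    refine ⟨t + j, hj.trans_le le_add_self, ?_⟩
    have := (harc h).2
    rw [hconst] at this
    simpa [eq_comm] using this
  · obtain ⟨r, hr⟩ := hθ j
    rw [← hconst j]
    rcases (harc hr).2 with ⟨-, h⟩ | ⟨-, h⟩
    exacts [h.le, h.le]

end ParityGraphs

/-! ### The strong pigeonhole principle -/

section Pigeonhole

variable {M : Type*} [L2Structure M] [hM : Fact (RCA0 M)]

/-- Every `i < k` with `modulus m i ∤ n` is a value of `c` on the interval `[y, s)`. -/
def AllOccur (c : Func M) (k m n y s : M) : Prop :=
  ∀ i, i < k → ¬ modulus m i ∣ n → ∃ x, x < s ∧ y ≤ x ∧ c x = i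

instance Bd.allOccur (c : Func M) (k m : M) (n y s : (ℕ → M) → M) [Tm n] [Tm y] [Tm s] :
    Bd fun v => AllOccur c k m (n v) (y v) (s v) := by
  unfold AllOccur; infer_instance

/-- The largest `y` for which all the values of `c` selected by `n` occur in `[y, s]` is larger
than that for `[y, s)`. -/
def Fires (c : Func M) (k m n s : M) : Prop :=
  ∃ y, y < s + 1 ∧ AllOccur c k m n y (s + 1) ∧ (y = s ∨ ¬ AllOccur c k m n y s)

instance Bd.fires (c : Func M) (k m : M) (n s : (ℕ → M) → M) [Tm n] [Tm s] :
    Bd fun v => Fires c k m (n v) (s v) := by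
  unfold Fires; infer_instance

theorem AllOccur.mono {c : Func M} {k m n y y' s s' : M} (h : AllOccur c k m n y s) (hy : y' ≤ y)
    (hs : s ≤ s') : AllOccur c k m n y' s' := fun i hi hn => by
  obtain ⟨x, hx, hyx, h⟩ := h i hi hn
  exact ⟨x, hx.trans_le hs, hy.trans hyx, h⟩

theorem infMany_of_infMany_fires {c : Func M} {k m n i : M} (h : InfMany (Fires c k m n))
    (hi : i < k) (hn : ¬ modulus m i ∣ n) : InfMany fun x => c x = i := by
  -- Each firing after stage `s` pushes the start of the interval beyond `y`: its start `y'` is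
  -- either the new stage itself, or fails on `[y', s')` where `y` succeeds.
  have key (y : M) : ∃ s, y ≤ s ∧ AllOccur c k m n y (s + 1) := by
    refine sigma_induction (fun y s : M => y ≤ s ∧ AllOccur c k m n y (s + 1)) ?_ ?_ y
    · obtain ⟨s, -, y, -, h, -⟩ := h 0
      exact ⟨s, zero_le, h.mono zero_le le_rfl⟩
    · rintro y ⟨s, hys, h'⟩
      obtain ⟨s', hs, y', hy', h₁, h₂⟩ := h s
      refine ⟨s', succ_le_iff.2 (hys.trans_lt hs), h₁.mono ?_ le_rfl⟩
      rw [succ_le_iff]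
      rcases h₂ with rfl | h₂
      · exact hys.trans_lt hs
      · by_contra! hle
        exact h₂ (h'.mono hle (succ_le_iff.2 hs))
  intro y
  obtain ⟨s, -, h⟩ := key (y + 1)
  obtain ⟨x, -, hx, h⟩ := h i hi hn
  exact ⟨x, succ_le_iff.1 hx, h⟩

theorem infMany_fires {c : Func M} {k m n : M}
    (h : ∀ i, i < k → ¬ modulus m i ∣ n → InfMany fun x => c x = i) :
    InfMany (Fires c k m n) := by
  intro N
  obtain ⟨b, hb⟩ := exists_bound (fun i x : M => ¬ modulus m i ∣ n → N + 1 ≤ x ∧ c x = i)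
    (fun _ _ _ _ => inferInstance) k fun i hi => by
      by_cases hn : modulus m i ∣ n
      · exact ⟨0, fun h => (h hn).elim⟩
      · obtain ⟨x, hx, h⟩ := h i hi hn N
        exact ⟨x, fun _ => ⟨succ_le_iff.2 hx, h⟩⟩
  -- The first stage by which all selected values have occurred from `N + 1` on is a firing stage:
  -- by minimality `[N + 1, s)` is not enough, unless `s = N + 1`.
  obtain ⟨s, ⟨hs, hocc⟩, hmin⟩ := exists_least
    (fun s : M => N + 1 ≤ s ∧ AllOccur c k m n (N + 1) (s + 1)) ⟨N + 1 + b, le_self_add,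
      fun i hi hn => by
        obtain ⟨x, hx, h⟩ := hb i hi
        exact ⟨x, (hx.trans_le le_add_self).trans_le le_self_add, h hn⟩⟩
  refine ⟨s, succ_le_iff.1 hs, N + 1, lt_succ_iff.2 hs, hocc, ?_⟩
  rcases hs.eq_or_lt with he | hlt
  · exact .inl he
  · right
    intro h
    rcases hM.out.eq_zero_or_succ s with rfl | ⟨r, rfl⟩
    · exact not_lt_zero hlt
    · exact hmin r (lt_succ_iff.2 le_rfl) ⟨lt_succ_iff.1 hlt, h⟩

theorem SCTCriterion.spp (h : SCTCriterion M) : SPP M := by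
  intro k c _
  obtain ⟨m, hm0, hm⟩ := exists_common_multiple k
  -- All moduli divide `K`, so it selects no colour and fires at every stage, through the
  -- alternative `y = s`; this makes the least firing number exist and bounds it.
  obtain ⟨K, hK0, hK⟩ := exists_modulus_dvd_iff hm0 hm {n : M | n = n}
  -- Zero is excluded because it is divisible by every modulus and would always fire.
  have hP (s : M) : ∃! n, (0 < n ∧ Fires c k m n s) ∧
      ∀ n', n' < n → ¬ (0 < n' ∧ Fires c k m n' s) := by
    obtain ⟨n, hn, hmin⟩ := exists_least (fun n : M => 0 < n ∧ Fires c k m n s)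
      ⟨K, hK0, s, lt_succ_iff.2 le_rfl, fun i hi hn => (hn ((hK i hi).2 rfl)).elim, .inl rfl⟩
    refine ⟨n, ⟨hn, hmin⟩, fun n' ⟨hn', hmin'⟩ => ?_⟩
    exact le_antisymm (not_lt.1 fun hlt => hmin' _ hlt hn) (not_lt.1 fun hlt => hmin _ hlt hn')
  let d : Func M := .ofRel _ (fun _ _ _ _ => inferInstance) hP
  have hd (s : M) := Func.ofRel_apply _ (fun _ _ _ _ => inferInstance) hP s
  have hle {n s : M} (hn : 0 < n) (hs : Fires c k m n s) : d s ≤ n :=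
    not_lt.1 fun hlt => (hd s).2 n hlt ⟨hn, hs⟩
  obtain ⟨n, hinf, t, ht⟩ := h.exists_liminf (K + 1) d fun s => lt_succ_iff.2 <|
    hle hK0 ⟨s, lt_succ_iff.2 le_rfl, fun i hi hn => (hn ((hK i hi).2 rfl)).elim, .inl rfl⟩
  have hn0 : 0 < n := by
    obtain ⟨s, -, rfl⟩ := hinf 0
    exact (hd s).1.1
  have hgood (i : M) (hi : i < k) (hn : ¬ modulus m i ∣ n) : InfMany fun x => c x = i :=
    infMany_of_infMany_fires (fun N => by
      obtain ⟨s, hs, rfl⟩ := hinf N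
      exact ⟨s, hs, (hd s).1.2⟩) hi hn
  refine ⟨{i | i < k ∧ ¬ modulus m i ∣ n}, Fact.out, fun i =>
    ⟨fun ⟨hi, hn⟩ => ⟨hi, hgood i hi hn⟩, fun ⟨hi, hci⟩ => ⟨hi, ?_⟩⟩⟩
  rintro ⟨n', rfl⟩
  have hn' : 0 < n' := pos_iff_ne_zero.2 fun h => by simp [h] at hn0
  have hlt : n' < modulus m i * n' := by
    simpa [mul_comm] using mul_lt_mul_of_lt (one_lt_modulus hm0 i) hn'
  -- Removing the factor `modulus m i` adds at most colour `i` to the selection, and `i` recurs by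
  -- assumption; so `n'` fires at some stage after `t`.
  obtain ⟨s, hs, hf⟩ := infMany_fires (c := c) (k := k) (m := m) (n := n') (fun j hj hjn => by
    by_cases hij : i = j
    · exact hij ▸ hci
    · exact hgood j hj fun hdvd => hjn (modulus_euclid hm hi hj hij hdvd)) t
  obtain ⟨j, rfl⟩ := le_iff_exists_add.1 hs.le
  exact ((ht j).trans (hle hn' hf)).not_gt hlt

end Pigeonhole

end SOA

/-- Every model of `RCA₀` that satisfies the SCT criterion for graphs satisfies the strong
pigeonhole principle; that is, `RCA₀` proves that the SCT criterion for graphs implies SPP. -/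
theorem mainTheorem3 (M : Type*) [L2Structure M] (hM : SOA.RCA0 M) :
    SOA.SCTCriterion M → SOA.SPP M :=
  haveI : Fact (SOA.RCA0 M) := ⟨hM⟩
  SOA.SCTCriterion.spp
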